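/- Let $\mathcal H$ be a complex Hilbert space and let $\mathfrak a$ be a densely defined sesquilinear form on $\mathcal H$ (not necessarily symmetric) with domain $D(\mathfrak a)$. Assume that $\mathfrak a$ is bounded from below, that is, for some $\eta\in\mathbb R$, $\operatorname{Re}\mathfrak a(u,u)+\eta\|u\|^2\ge 0$ for all $u\in D(\mathfrak a)$. Assume also that, for the norm $\|u\|_{\mathfrak a}:=\left(\operatorname{Re}\mathfrak a(u,u)+(\eta+1)\|u\|^2\right)^{1/2}$, $\mathfrak a$ is continuous (there is $M$ with $|\mathfrak a(u,v)|\le M\|u\|_{\mathfrak a}\|v\|_{\mathfrak a}$ for all $u,v\in D(\mathfrak a)$) and closed ($D(\mathfrak a)$ is complete for $\|\cdot\|_{\mathfrak a}$). Let $A$ be the operator associated with $\mathfrak a$: $u\in D(A)$ and $Au=f$ if and only if $u\in D(\mathfrak a)$ and $\mathfrak a(u,v)=\langle f,v\rangle$ for all $v\in D(\mathfrak a)$. Let $H$ be the self-adjoint operator associated in the same way with the symmetric part $\mathfrak h(u,v):=\frac12\left(\mathfrak a(u,v)+\overline{\mathfrak a(v,u)}\right)$, $D(\mathfrak h)=D(\mathfrak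 a)$. (i) If the negative spectrum $\sigma(H)\cap(-\infty,0)$ of $H$ is empty, then $A$ has no eigenvalue in $\{z\in\mathbb C:\operatorname{Re}z<0\}$. (ii) Assume that the negative spectrum of $H$ is discrete, that is, every point of $\sigma(H)\cap(-\infty,0)$ is an isolated point of $\sigma(H)$ and an eigenvalue of $H$ of finite multiplicity. Let $\lambda_1,\dots,\lambda_N$ be any finite family of eigenvalues of $A$ with $\operatorname{Re}\lambda_k<0$ for all $k$, in which each eigenvalue $\lambda$ occurs at most $m_a(\lambda)$ times, where $m_a(\lambda):=\sup_{j\in\mathbb N}\dim\ker(\lambda I-A)^j\in\{1,2,\dots,\infty\}$ is its algebraic multiplicity. Then, for every $\gamma\ge 1$, $$\sum_{k=1}^N(-\operatorname{Re}\lambda_k)^\gamma\le\operatorname{Tr}(H)_-^\gamma,$$ where $\operatorname{Tr}(H)_-^\gamma:=\sum_j(-\mu_j)^\gamma\in[0,\infty]$ is the sum over the negative eigenvalues $\mu_j$ of $H$, repeated according to multiplicity. -/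

import Mathlib

open Filter Topology
open scoped ENNReal

namespace LiebThirring

section Operators

variable {E : Type*} [NormedAddCommGroup E] [InnerProductSpace ℂ E]

/-- The resolvent set of a (possibly unbounded) operator `T` with domain `T.domain`: the `z` for
which `z - T`, from `T.domain` to `E`, has an everywhere defined bounded two-sided inverse. -/
def resolventSet (T : E →ₗ.[ℂ] E) : Set ℂ :=
  {z | ∃ R : E →L[ℂ] E,
    (∀ x : E, ∃ h : R x ∈ T.domain, z • R x - T ⟨R x, h⟩ = x) ∧
    (∀ u : T.domain, R (z • (u : E) - T u) = u)}

/-- The spectrum of a (possibly unbounded) operator. -/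
def spectrum (T : E →ₗ.[ℂ] E) : Set ℂ :=
  (resolventSet T)ᶜ

/-- `ker (z - T) ^ k`, where `(z - T) ^ k` has its natural domain: `u` lies in
`ker (z - T) ^ (k + 1)` iff `u ∈ T.domain` and `z u - T u` lies in `ker (z - T) ^ k`. -/
def kerPow (T : E →ₗ.[ℂ] E) (z : ℂ) : ℕ → Submodule ℂ E
  | 0 => ⊥
  | k + 1 => ((kerPow T z k).comap (z • T.domain.subtype - T.toFun)).map T.domain.subtype

/-- The eigenspace `ker (z - T)`. -/
def eigenspace (T : E →ₗ.[ℂ] E) (z : ℂ) : Submodule ℂ E :=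
  (LinearMap.ker (z • T.domain.subtype - T.toFun)).map T.domain.subtype

/-- `z` is an eigenvalue of `T`. -/
def IsEigenvalue (T : E →ₗ.[ℂ] E) (z : ℂ) : Prop :=
  ∃ u : T.domain, (u : E) ≠ 0 ∧ T u = z • (u : E)

/-- The dimension of a subspace, in `{0, 1, 2, …, ∞}`. -/
noncomputable def edim (V : Submodule ℂ E) : ℕ∞ :=
  Cardinal.toENat (Module.rank ℂ V)

/-- The algebraic multiplicity `sup_k dim ker (z - T) ^ k`, possibly infinite. -/
noncomputable def algMult (T : E →ₗ.[ℂ] E) (z : ℂ) : ℕ∞ :=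
  ⨆ k : ℕ, edim (kerPow T z k)

/-- The negative spectrum `σ(T) ∩ (-∞, 0)`. -/
def negSpectrum (T : E →ₗ.[ℂ] E) : Set ℝ :=
  {t | t < 0 ∧ (t : ℂ) ∈ spectrum T}

/-- The negative spectrum is discrete: each of its points is an isolated point of the spectrum and
an eigenvalue of finite multiplicity. The points may accumulate at `0`. -/
def NegSpectrumDiscrete (T : E →ₗ.[ℂ] E) : Prop :=
  ∀ t ∈ negSpectrum T,
    (∃ ε > 0, ∀ z ∈ spectrum T, dist z (t : ℂ) < ε → z = t) ∧
    IsEigenvalue T t ∧ FiniteDimensional ℂ (eigenspace T t)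

/-- `Tr (T)_-^γ = ∑ (-μ)^γ` in `[0, ∞]`, the sum running over the negative eigenvalues `μ` of `T`,
each counted with its multiplicity. -/
noncomputable def trNegPow (T : E →ₗ.[ℂ] E) (γ : ℝ) : ℝ≥0∞ :=
  ∑' μ : {t : ℝ // t < 0 ∧ IsEigenvalue T t},
    ((edim (eigenspace T (μ.1 : ℂ)) : ℕ∞) : ℝ≥0∞) * ENNReal.ofReal ((-μ.1) ^ γ)

end Operators

/-- A densely defined sesquilinear form on `E`, linear in the first and conjugate linear in the
second variable. It need not be symmetric. -/
structure DenseForm (E : Type*) [NormedAddCommGroup E] [InnerProductSpace ℂ E] where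
  /-- the domain of the form -/
  domain : Submodule ℂ E
  /-- the form itself -/
  form : domain →ₗ[ℂ] domain →ₗ⋆[ℂ] ℂ
  dense : Dense (domain : Set E)

namespace DenseForm

variable {E : Type*} [NormedAddCommGroup E] [InnerProductSpace ℂ E]

/-- `Re a(u,u) + η ‖u‖² ≥ 0` on the domain of `a`. -/
def BoundedBelowBy (a : DenseForm E) (η : ℝ) : Prop :=
  ∀ u : a.domain, 0 ≤ (a.form u u).re + η * ‖(u : E)‖ ^ 2

/-- The form norm `(Re a(u,u) + (η + 1) ‖u‖²)^(1/2)`, where `η` is such that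
`Re a(u,u) + η ‖u‖² ≥ 0`. Different such `η` give equivalent norms. -/
noncomputable def formNorm (a : DenseForm E) (η : ℝ) (u : a.domain) : ℝ :=
  Real.sqrt ((a.form u u).re + (η + 1) * ‖(u : E)‖ ^ 2)

/-- The form is continuous for its form norm. -/
def IsContinuousForm (a : DenseForm E) (η : ℝ) : Prop :=
  ∃ M : ℝ, ∀ u v : a.domain, ‖a.form u v‖ ≤ M * a.formNorm η u * a.formNorm η v

/-- The form is closed: its domain is complete for the form norm. -/
def IsClosedForm (a : DenseForm E) (η : ℝ) : Prop :=
  ∀ u : ℕ → a.domain,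
    (∀ ε > 0, ∃ N, ∀ m ≥ N, ∀ n ≥ N, a.formNorm η (u m - u n) < ε) →
    ∃ v : a.domain, Tendsto (fun n => a.formNorm η (u n - v)) atTop (𝓝 0)

/-- The symmetric part `(u, v) ↦ (a(u,v) + conj a(v,u)) / 2`. -/
noncomputable def symmPart (a : DenseForm E) : DenseForm E where
  domain := a.domain
  form := LinearMap.mk₂'ₛₗ (RingHom.id ℂ) (starRingEnd ℂ)
    (fun u v => (1 / 2 : ℂ) * (a.form u v + starRingEnd ℂ (a.form v u)))
    (by intro u u' v; simp; ring)
    (by intro c u v; simp; ring)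
    (by intro u v v'; simp; ring)
    (by intro c u v; simp; ring)
  dense := a.dense

theorem eq_of_represents (a : DenseForm E) {f g : E}
    (h : ∀ v : a.domain, inner ℂ (v : E) f = inner ℂ (v : E) g) : f = g :=
  a.dense.eq_of_inner_right ℂ fun v hv => h ⟨v, hv⟩

/-- The domain of the associated operator: all `u ∈ D(a)` for which some `f ∈ E` satisfies
`a(u,v) = ⟨f, v⟩` for all `v ∈ D(a)`. (The scalar product `⟨f, v⟩`, linear in `f`, is
`inner ℂ v f`.) -/
def opDomain (a : DenseForm E) : Submodule ℂ E where
  carrier := {u | ∃ (hu : u ∈ a.domain) (f : E),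
    ∀ v : a.domain, a.form ⟨u, hu⟩ v = inner ℂ (v : E) f}
  zero_mem' := ⟨a.domain.zero_mem, 0, fun v => by
    have : (⟨0, a.domain.zero_mem⟩ : a.domain) = 0 := rfl
    simp [this]⟩
  add_mem' := by
    rintro u w ⟨hu, f, hf⟩ ⟨hw, g, hg⟩
    refine ⟨a.domain.add_mem hu hw, f + g, fun v => ?_⟩
    have : (⟨u + w, a.domain.add_mem hu hw⟩ : a.domain) = ⟨u, hu⟩ + ⟨w, hw⟩ := rfl
    rw [this, map_add, LinearMap.add_apply, hf, hg, inner_add_right]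
  smul_mem' := by
    rintro c u ⟨hu, f, hf⟩
    refine ⟨a.domain.smul_mem c hu, c • f, fun v => ?_⟩
    have : (⟨c • u, a.domain.smul_mem c hu⟩ : a.domain) = c • ⟨u, hu⟩ := rfl
    rw [this, map_smul, LinearMap.smul_apply, hf, inner_smul_right, smul_eq_mul]

theorem opDomain_le (a : DenseForm E) {u : E} (hu : u ∈ a.opDomain) : u ∈ a.domain :=
  hu.1

/-- The vector `f` with `a(u,v) = ⟨f, v⟩` for all `v ∈ D(a)`. -/
noncomputable def opVal (a : DenseForm E) (u : a.opDomain) : E :=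
  Classical.choose u.2.2

theorem opVal_spec (a : DenseForm E) (u : a.opDomain) (v : a.domain) :
    a.form ⟨u, a.opDomain_le u.2⟩ v = inner ℂ (v : E) (a.opVal u) :=
  Classical.choose_spec u.2.2 v

/-- The operator associated with the form. -/
noncomputable def operator (a : DenseForm E) : E →ₗ.[ℂ] E where
  domain := a.opDomain
  toFun :=
    { toFun := a.opVal
      map_add' := fun u w => a.eq_of_represents fun v => by
        have : (⟨((u + w : a.opDomain) : E), a.opDomain_le (u + w).2⟩ : a.domain)
          = ⟨u, a.opDomain_le u.2⟩ + ⟨w, a.opDomain_le w.2⟩ := rfl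
        rw [← a.opVal_spec, this, map_add, LinearMap.add_apply, a.opVal_spec, a.opVal_spec,
          inner_add_right]
      map_smul' := fun c u => a.eq_of_represents fun v => by
        have : (⟨((c • u : a.opDomain) : E), a.opDomain_le (c • u).2⟩ : a.domain)
          = c • ⟨u, a.opDomain_le u.2⟩ := rfl
        rw [← a.opVal_spec, this, map_smul, LinearMap.smul_apply, a.opVal_spec,
          RingHom.id_apply, inner_smul_right, smul_eq_mul] }

/-- `u ∈ D(A)` and `A u = f` iff `u ∈ D(a)` and `a(u,v) = ⟨f, v⟩` for all `v ∈ D(a)`. -/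
theorem mem_graph_operator (a : DenseForm E) (u f : E) :
    (u, f) ∈ a.operator.graph ↔
      ∃ hu : u ∈ a.domain, ∀ v : a.domain, a.form ⟨u, hu⟩ v = inner ℂ (v : E) f := by
  rw [LinearPMap.mem_graph_iff]
  constructor
  · rintro ⟨w, hw, hf⟩
    obtain rfl : (w : E) = u := hw
    obtain rfl : a.opVal w = f := hf
    exact ⟨a.opDomain_le w.2, a.opVal_spec w⟩
  · rintro ⟨hu, hf⟩
    refine ⟨(⟨u, hu, f, hf⟩ : a.opDomain), rfl, ?_⟩
    refine a.eq_of_represents fun v => ?_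
    rw [← hf v]
    exact (a.opVal_spec ⟨u, hu, f, hf⟩ v).symm

end DenseForm

end LiebThirring

/-!
The argument compares diagonal matrix entries. Write `a` for the form with operator `A`, and `h` for
its symmetric part with operator `H`.

By Schur triangularization (`exists_orthonormal_invariant`), numbers `lam k` that are repeated no
more often than their algebraic multiplicities are the diagonal entries `⟨A e k, e k⟩` of `A` in an
orthonormal family `e`, so that `Re (lam k) = h(e k, e k)`: passing to the symmetric part costs
nothing on the diagonal.

It remains to bound `-h(u, u)` from above by the negative part of `H`. The form domain is a Hilbert
space `V` for the scalar product `h + c ⟨·, ·⟩`, where `c = η + 1`, with a bounded inclusion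
`j : V → E`, and `h(u, u)` is the quadratic form of `1 - c S` on `V`, where `S = j† j`. A nonzero
spectral value `s` of `S` corresponds to the point `1 / s - c` of the spectrum of `H`
(`IsAssociated.notMem_spectrum`), negative spectrum of `H` to `c s > 1`. As the negative spectrum of
`H` is discrete, the part of the spectrum of `S` in `c s ≥ 1 + ε` is finite and consists of isolated
points, and the continuous functional calculus bounds `c S - 1 - ε` by finitely many spectral
projections (`exists_finset_projections`). In terms of `H` this says that `-h(u, u)` is at most
`ε ‖u‖_V ^ 2 + ∑ (-μ) ‖P_μ u‖ ^ 2`, a sum over finitely many negative eigenvalues `μ` with their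
eigenprojections `P_μ` on `E` (`IsAssociated.exists_finset_le`).

If `H` has no negative spectrum, the sum is empty and `h ≥ 0`, which excludes eigenvalues of `A` with
negative real part. In general, the squared inner products of the `e k` with orthonormal eigenvectors
of `H` form a doubly substochastic matrix, and Jensen's inequality for `x ↦ x ^ γ` gives the bound
for the sum of the powers (`sum_rpow_le_of_le_sum_inner`), up to `ε`, which tends to `0`.
-/

namespace LiebThirring

/-! ### Generalized eigenvectors and a Schur basis -/

section Schur

variable {E : Type*} [NormedAddCommGroup E] [InnerProductSpace ℂ E]

theorem mem_kerPow_succ (T : E →ₗ.[ℂ] E) (z : ℂ) (k : ℕ) (u : E) :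
    u ∈ kerPow T z (k + 1) ↔ ∃ h : u ∈ T.domain, z • u - T ⟨u, h⟩ ∈ kerPow T z k := by
  constructor
  · rintro ⟨w, hw, rfl⟩
    exact ⟨w.2, hw⟩
  · rintro ⟨h, hu⟩
    exact ⟨⟨u, h⟩, hu, rfl⟩

theorem mem_eigenspace (T : E →ₗ.[ℂ] E) (z : ℂ) (u : E) :
    u ∈ eigenspace T z ↔ ∃ h : u ∈ T.domain, T ⟨u, h⟩ = z • u := by
  constructor
  · rintro ⟨w, hw, rfl⟩
    exact ⟨w.2, (sub_eq_zero.1 (LinearMap.mem_ker.1 hw)).symm⟩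
  · rintro ⟨h, hu⟩
    exact ⟨⟨u, h⟩, LinearMap.mem_ker.2 (sub_eq_zero.2 hu.symm), rfl⟩

theorem edim_eq_finrank (V : Submodule ℂ E) [FiniteDimensional ℂ V] :
    edim V = (Module.finrank ℂ V : ℕ∞) := by
  rw [edim, ← Module.finrank_eq_rank, Cardinal.toENat_nat]

/-- If some power of `z - T` has a kernel not contained in the invariant subspace `W`, then the
quotient by `W` contains an eigenvector for `z`. -/
theorem exists_notMem_sub_mem (T : E →ₗ.[ℂ] E) (z : ℂ) (W : Submodule ℂ E) {j : ℕ}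
    (hj : ¬ kerPow T z j ≤ W) :
    ∃ (w : E) (h : w ∈ T.domain), w ∉ W ∧ T ⟨w, h⟩ - z • w ∈ W := by
  induction j with
  | zero => exact absurd bot_le hj
  | succ j ih =>
    by_cases hW : kerPow T z j ≤ W
    · obtain ⟨w, hw, hwW⟩ := SetLike.not_le_iff_exists.1 hj
      obtain ⟨h, hw⟩ := (mem_kerPow_succ T z j w).1 hw
      exact ⟨w, h, hwW, by simpa using W.neg_mem (hW hw)⟩
    · exact ih hW

/-- Enlarging an invariant subspace `W` by an eigenvector modulo `W` for `l` adds no generalized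
eigenvectors for other values `z`. -/
theorem kerPow_inf_sup_le {T : E →ₗ.[ℂ] E} {W : Submodule ℂ E} {l z : ℂ} {e : E}
    (hW : ∀ u ∈ W, ∃ h : u ∈ T.domain, T ⟨u, h⟩ ∈ W) (he : e ∈ T.domain)
    (hTe : T ⟨e, he⟩ - l • e ∈ W) (hz : z ≠ l) (j : ℕ) :
    kerPow T z j ⊓ (W ⊔ Submodule.span ℂ {e}) ≤ W := by
  induction j with
  | zero => exact inf_le_left.trans bot_le
  | succ j ih =>
    rintro u ⟨hu, huW⟩
    obtain ⟨h, hu⟩ := (mem_kerPow_succ T z j u).1 hu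
    obtain ⟨x, hx, y, hy, rfl⟩ := Submodule.mem_sup.1 huW
    obtain ⟨c, rfl⟩ := Submodule.mem_span_singleton.1 hy
    obtain ⟨hxd, hTx⟩ := hW x hx
    have hT : T ⟨x + c • e, h⟩ = T ⟨x, hxd⟩ + c • T ⟨e, he⟩ := by
      rw [← T.map_smul, ← T.map_add]; rfl
    have hrest : z • x - T ⟨x, hxd⟩ - c • (T ⟨e, he⟩ - l • e) ∈ W :=
      W.sub_mem (W.sub_mem (W.smul_mem _ hx) hTx) (W.smul_mem _ hTe)
    have hsplit : z • (x + c • e) - T ⟨x + c • e, h⟩ =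
        (z • x - T ⟨x, hxd⟩ - c • (T ⟨e, he⟩ - l • e)) + ((z - l) * c) • e := by
      rw [hT]; module
    have hmem : z • (x + c • e) - T ⟨x + c • e, h⟩ ∈ W := by
      refine ih ⟨hu, ?_⟩
      rw [hsplit]
      exact Submodule.add_mem_sup hrest
        (Submodule.smul_mem _ _ (Submodule.mem_span_singleton_self e))
    rw [hsplit, W.add_mem_iff_right hrest, mul_smul,
      W.smul_mem_iff (sub_ne_zero.2 hz)] at hmem
    exact W.add_mem hx hmem

theorem finrank_inf_sup_span_singleton_le (K W : Submodule ℂ E) [FiniteDimensional ℂ W] (e : E) :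
    Module.finrank ℂ ↥(K ⊓ (W ⊔ Submodule.span ℂ {e})) ≤ Module.finrank ℂ ↥(K ⊓ W) + 1 := by
  set W' := W ⊔ Submodule.span ℂ {e}
  have h1 := Submodule.finrank_sup_add_finrank_inf_eq (K ⊓ W') W
  have h2 : K ⊓ W' ⊓ W = K ⊓ W := by
    rw [inf_assoc, inf_eq_right.2 (le_sup_left : W ≤ W')]
  have h3 : Module.finrank ℂ ↥(K ⊓ W' ⊔ W) ≤ Module.finrank ℂ W' :=
    Submodule.finrank_mono (sup_le inf_le_right le_sup_left)
  have h4 : Module.finrank ℂ W' ≤ Module.finrank ℂ W + 1 :=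
    (Submodule.finrank_add_le_finrank_add_finrank _ _).trans
      (by gcongr; exact (finrank_span_le_card {e}).trans (by simp))
  rw [h2] at h1
  omega

/-- A vector outside a finite-dimensional invariant subspace `W` on which `T - l` takes a value in
`W` may be taken to be a unit vector orthogonal to `W`. -/
theorem exists_unit_orthogonal_sub_mem {T : E →ₗ.[ℂ] E} {W : Submodule ℂ E}
    [FiniteDimensional ℂ W] {l : ℂ} (hW : ∀ u ∈ W, ∃ h : u ∈ T.domain, T ⟨u, h⟩ ∈ W)
    {w : E} (hw : w ∈ T.domain) (hwW : w ∉ W) (hTw : T ⟨w, hw⟩ - l • w ∈ W) :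
    ∃ (e : E) (h : e ∈ T.domain), ‖e‖ = 1 ∧ e ∈ Wᗮ ∧ T ⟨e, h⟩ - l • e ∈ W := by
  set p := W.starProjection w
  have hp : p ∈ W := W.starProjection_apply_mem w
  obtain ⟨hpd, hTp⟩ := hW p hp
  have hne : w - p ≠ 0 := fun h => hwW (by rwa [sub_eq_zero.1 h])
  refine ⟨(‖w - p‖⁻¹ : ℂ) • (w - p), T.domain.smul_mem _ (T.domain.sub_mem hw hpd), ?_, ?_, ?_⟩
  · exact norm_smul_inv_norm hne
  · exact Submodule.smul_mem _ _ (W.sub_starProjection_mem_orthogonal w)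
  · have hT : T ⟨(‖w - p‖⁻¹ : ℂ) • (w - p),
        T.domain.smul_mem _ (T.domain.sub_mem hw hpd)⟩ =
          (‖w - p‖⁻¹ : ℂ) • (T ⟨w, hw⟩ - T ⟨p, hpd⟩) := by
      rw [← T.map_sub, ← T.map_smul]; rfl
    have hsplit : (‖w - p‖⁻¹ : ℂ) • (T ⟨w, hw⟩ - T ⟨p, hpd⟩) -
        l • (‖w - p‖⁻¹ : ℂ) • (w - p) =
        (‖w - p‖⁻¹ : ℂ) • ((T ⟨w, hw⟩ - l • w) - (T ⟨p, hpd⟩ - l • p)) := by module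
    rw [hT, hsplit]
    exact W.smul_mem _ (W.sub_mem hTw (W.sub_mem hTp (W.smul_mem _ hp)))

/-- Schur triangularization: complex numbers repeated no more often than their algebraic
multiplicities are the diagonal matrix entries of `T` in some orthonormal family. The invariant
subspace `W` and the bound on its generalized eigenvectors are what the induction over the length of
the family carries along. -/
theorem exists_orthonormal_invariant (T : E →ₗ.[ℂ] E) (N : ℕ) (lam : Fin N → ℂ)
    (hmult : ∀ z : ℂ, (((Finset.univ.filter fun k => lam k = z).card : ℕ) : ℕ∞) ≤ algMult T z) :
    ∃ (e : Fin N → E) (W : Submodule ℂ E), Orthonormal ℂ e ∧ FiniteDimensional ℂ W ∧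
      (∀ k, e k ∈ W) ∧ (∀ u ∈ W, ∃ h : u ∈ T.domain, T ⟨u, h⟩ ∈ W) ∧
      (∀ z j, Module.finrank ℂ ↥(kerPow T z j ⊓ W) ≤
        (Finset.univ.filter fun k => lam k = z).card) ∧
      ∀ k, ∃ h : e k ∈ T.domain, inner ℂ (e k) (T ⟨e k, h⟩) = lam k := by
  induction N with
  | zero =>
    refine ⟨Fin.elim0, ⊥, ⟨fun k => k.elim0, fun k => k.elim0⟩, inferInstance, fun k => k.elim0,
      ?_, ?_, fun k => k.elim0⟩
    · rintro u rfl
      exact ⟨T.domain.zero_mem, (Submodule.mem_bot ℂ).2 T.map_zero⟩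
    · intro z j
      simp
  | succ N ih =>
    have hcount : ∀ z, (Finset.univ.filter fun k => lam k = z).card =
        (Finset.univ.filter fun k : Fin N => lam k.castSucc = z).card +
          if lam (Fin.last N) = z then 1 else 0 := by
      intro z
      simp only [Finset.card_filter, Fin.sum_univ_castSucc]
    obtain ⟨e, W, he, hfin, heW, hW, hdim, hdiag⟩ := ih (fun k => lam k.castSucc) fun z =>
      le_trans (by rw [hcount z]; exact_mod_cast Nat.le_add_right _ _) (hmult z)
    set l := lam (Fin.last N)
    have hlt : (((Finset.univ.filter fun k : Fin N => lam k.castSucc = l).card : ℕ) : ℕ∞) <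
        algMult T l := by
      refine lt_of_lt_of_le ?_ (hmult l)
      rw [hcount l, if_pos rfl]
      exact_mod_cast Nat.lt_succ_self _
    obtain ⟨j, hj⟩ := lt_iSup_iff.1 hlt
    have hnot : ¬ kerPow T l j ≤ W := by
      intro hle
      have : FiniteDimensional ℂ (kerPow T l j) := Submodule.finiteDimensional_of_le hle
      have h := hdim l j
      rw [inf_eq_left.2 hle] at h
      rw [edim_eq_finrank] at hj
      exact absurd (Nat.cast_lt.1 hj) (not_lt.2 h)
    obtain ⟨w, hwd, hwW, hTw⟩ := exists_notMem_sub_mem T l W hnot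
    obtain ⟨f, hfd, hf1, hfW, hTf⟩ := exists_unit_orthogonal_sub_mem hW hwd hwW hTw
    have hle : W ≤ W ⊔ Submodule.span ℂ {f} := le_sup_left
    have hfmem : f ∈ W ⊔ Submodule.span ℂ {f} :=
      Submodule.mem_sup_right (Submodule.mem_span_singleton_self f)
    refine ⟨Fin.snoc e f, W ⊔ Submodule.span ℂ {f}, ?_, inferInstance, ?_, ?_, ?_, ?_⟩
    · refine ⟨fun k => ?_, fun i k hik => ?_⟩
      · refine Fin.lastCases ?_ (fun k => ?_) k
        · simpa using hf1
        · simpa using he.1 k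
      · induction i using Fin.lastCases with
        | last =>
          induction k using Fin.lastCases with
          | last => exact absurd rfl hik
          | cast k => simpa using Submodule.inner_left_of_mem_orthogonal (heW k) hfW
        | cast i =>
          induction k using Fin.lastCases with
          | last => simpa using Submodule.inner_right_of_mem_orthogonal (heW i) hfW
          | cast k => simpa using he.2 (fun h => hik (by rw [h]))
    · intro k
      induction k using Fin.lastCases with
      | last => simpa using hfmem
      | cast k => simpa using hle (heW k)
    · intro u hu
      obtain ⟨x, hx, y, hy, rfl⟩ := Submodule.mem_sup.1 hu
      obtain ⟨c, rfl⟩ := Submodule.mem_span_singleton.1 hy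
      obtain ⟨hxd, hTx⟩ := hW x hx
      have hT : T ⟨x + c • f, T.domain.add_mem hxd (T.domain.smul_mem c hfd)⟩ =
          (T ⟨x, hxd⟩ + c • (T ⟨f, hfd⟩ - l • f)) + (c * l) • f := by
        have : T ⟨x + c • f, T.domain.add_mem hxd (T.domain.smul_mem c hfd)⟩ =
            T ⟨x, hxd⟩ + c • T ⟨f, hfd⟩ := by
          rw [← T.map_smul, ← T.map_add]; rfl
        rw [this]; module
      refine ⟨T.domain.add_mem hxd (T.domain.smul_mem c hfd), ?_⟩
      rw [hT]
      exact Submodule.add_mem _ (hle (W.add_mem hTx (W.smul_mem _ hTf)))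
        (Submodule.smul_mem _ _ hfmem)
    · intro z j
      rw [hcount z]
      by_cases hz : l = z
      · rw [if_pos hz]
        exact (finrank_inf_sup_span_singleton_le _ W f).trans (by gcongr; exact hdim z j)
      · rw [if_neg hz, add_zero]
        refine le_trans (Submodule.finrank_mono ?_) (hdim z j)
        exact le_inf inf_le_left (kerPow_inf_sup_le hW hfd hTf (Ne.symm hz) j)
    · intro k
      induction k using Fin.lastCases with
      | last =>
        have h0 : inner ℂ f (T ⟨f, hfd⟩ - l • f) = 0 :=
          Submodule.inner_left_of_mem_orthogonal hTf hfW
        rw [inner_sub_right, inner_smul_right, inner_self_eq_norm_sq_to_K, hf1, sub_eq_zero,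
          RCLike.ofReal_one, one_pow, mul_one] at h0
        simpa using ⟨hfd, h0⟩
      | cast k => simpa using hdiag k

end Schur

/-! ### Convexity -/

section Convexity

variable {E : Type*} [NormedAddCommGroup E] [InnerProductSpace ℂ E]

/-- Jensen's inequality for weights of total mass at most one. -/
theorem rpow_sum_mul_le {ι : Type*} (s : Finset ι) (w x : ι → ℝ) (hw : ∀ i ∈ s, 0 ≤ w i)
    (hw1 : ∑ i ∈ s, w i ≤ 1) (hx : ∀ i ∈ s, 0 ≤ x i) {γ : ℝ} (hγ : 1 ≤ γ) :
    (∑ i ∈ s, w i * x i) ^ γ ≤ ∑ i ∈ s, w i * x i ^ γ := by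
  -- The missing mass is placed at the point `0`, where `x ↦ x ^ γ` vanishes.
  have h := (convexOn_rpow hγ).map_add_sum_le (t := s) (w := w) (p := x)
    (v := 1 - ∑ i ∈ s, w i) (q := 0) hw (by ring) hx (by linarith) Set.self_mem_Ici
  simpa [Real.zero_rpow (by linarith : γ ≠ 0)] using h

/-- If the `y k` are dominated by the diagonal entries of `∑ i, x i ⟨φ i, ·⟩ φ i` in an orthonormal
family, then `∑ k, y k ^ γ ≤ ∑ i, x i ^ γ`: the squared inner products form a doubly substochastic
matrix by Bessel's inequality. -/
theorem sum_rpow_le_of_le_sum_inner {ι κ : Type*} [Fintype ι] [Fintype κ] {e : κ → E} {φ : ι → E}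
    (he : Orthonormal ℂ e) (hφ : Orthonormal ℂ φ) {x : ι → ℝ} {y : κ → ℝ} (hx : ∀ i, 0 ≤ x i)
    (hy : ∀ k, 0 ≤ y k) (h : ∀ k, y k ≤ ∑ i, x i * ‖inner ℂ (φ i) (e k)‖ ^ 2)
    {γ : ℝ} (hγ : 1 ≤ γ) : ∑ k, y k ^ γ ≤ ∑ i, x i ^ γ := by
  calc ∑ k, y k ^ γ ≤ ∑ k, ∑ i, ‖inner ℂ (φ i) (e k)‖ ^ 2 * x i ^ γ := by
        refine Finset.sum_le_sum fun k _ => ?_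
        calc y k ^ γ ≤ (∑ i, ‖inner ℂ (φ i) (e k)‖ ^ 2 * x i) ^ γ := by
              refine Real.rpow_le_rpow (hy k) ?_ (by linarith)
              simpa only [mul_comm] using h k
          _ ≤ _ := by
              refine rpow_sum_mul_le _ _ _ (fun i _ => sq_nonneg _) ?_ (fun i _ => hx i) hγ
              exact (hφ.sum_inner_products_le (e k)).trans (by rw [he.1 k]; norm_num)
    _ = ∑ i, (∑ k, ‖inner ℂ (e k) (φ i)‖ ^ 2) * x i ^ γ := by
        rw [Finset.sum_comm]
        simp only [Finset.sum_mul, norm_inner_symm]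
    _ ≤ ∑ i, x i ^ γ := by
        refine Finset.sum_le_sum fun i _ => ?_
        refine mul_le_of_le_one_left (Real.rpow_nonneg (hx i) _) ?_
        exact (he.sum_inner_products_le (φ i)).trans (by rw [hφ.1 i]; norm_num)

end Convexity

/-! ### Isolated spectral points of bounded self-adjoint operators -/

section Bounded

theorem inner_real_smul_left_complex {V : Type*} [NormedAddCommGroup V] [InnerProductSpace ℂ V]
    (r : ℝ) (x y : V) :
    inner ℂ (r • x) y = (r : ℂ) * inner ℂ x y := by
  rw [← Complex.coe_smul, inner_smul_left, Complex.conj_ofReal]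

variable {V : Type*} [NormedAddCommGroup V] [InnerProductSpace ℂ V] [CompleteSpace V]

/-- A function that is supported on one point is continuous on any set in which this point is
isolated. -/
theorem continuousOn_ite_eq_of_isolated {σ : Set ℝ} {s : ℝ}
    (hs : ∃ δ > 0, ∀ x ∈ σ, dist x s < δ → x = s) :
    ContinuousOn (fun x => if x = s then (1 : ℝ) else 0) σ := by
  obtain ⟨δ, hδ, h⟩ := hs
  intro x hx
  by_cases hxs : x = s
  · refine (continuousWithinAt_const (b := (1 : ℝ))).congr_of_eventuallyEq ?_ (if_pos hxs)
    subst hxs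
    filter_upwards [self_mem_nhdsWithin,
      mem_nhdsWithin_of_mem_nhds (Metric.ball_mem_nhds x hδ)] with y hy hys
    exact if_pos (h y hy hys)
  · refine (continuousWithinAt_const (b := (0 : ℝ))).congr_of_eventuallyEq ?_ (if_neg hxs)
    filter_upwards [mem_nhdsWithin_of_mem_nhds (isOpen_ne.mem_nhds hxs)] with y hy
    exact if_neg hy

/-- If every spectral value `s` of a self-adjoint operator `S` with `1 < c * s` is isolated, then
for each `ε > 0` only finitely many spectral projections `P s` are needed to dominate
`c * S - 1 - ε` by a combination of them; each `P s` maps into the eigenspace of `s`. -/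
theorem exists_finset_projections (S : V →L[ℂ] V) (hS : IsSelfAdjoint S) (c : ℝ)
    (hiso : ∀ s ∈ _root_.spectrum ℝ S, 1 < c * s →
      ∃ δ > 0, ∀ x ∈ _root_.spectrum ℝ S, dist x s < δ → x = s) {ε : ℝ} (hε : 0 < ε) :
    ∃ (F : Finset ℝ) (P : ℝ → V →L[ℂ] V), (∀ s ∈ F, s ∈ _root_.spectrum ℝ S ∧ 1 < c * s) ∧
      (∀ s ∈ F, ∀ u, S (P s u) = (s : ℂ) • P s u) ∧
      (∀ s ∈ F, ∀ u, inner ℂ (P s u) u = ((‖P s u‖ ^ 2 : ℝ) : ℂ)) ∧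
      ∀ u, c * (inner ℂ (S u) u).re - ‖u‖ ^ 2 ≤
        ε * ‖u‖ ^ 2 + ∑ s ∈ F, (c * s - 1) * ‖P s u‖ ^ 2 := by
  set σ := _root_.spectrum ℝ S
  have hfin : (σ ∩ {x | 1 + ε ≤ c * x}).Finite := by
    refine ((spectrum.isCompact S).inter_right
      (isClosed_le continuous_const (by fun_prop))).finite ?_
    rw [isDiscrete_iff_forall_mem_exists_isOpen]
    intro s hs
    obtain ⟨δ, hδ, h⟩ := hiso s hs.1 (by linarith [hs.2.out])
    refine ⟨Metric.ball s δ, Metric.isOpen_ball, Set.Subset.antisymm ?_ ?_⟩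
    · exact fun x hx => h x hx.2.1 hx.1
    · rintro x rfl
      exact ⟨Metric.mem_ball_self hδ, hs⟩
  set F := hfin.toFinset
  have hF : ∀ s, s ∈ F ↔ s ∈ σ ∧ 1 + ε ≤ c * s := fun s => by simp [F]
  set χ : ℝ → ℝ → ℝ := fun s x => if x = s then 1 else 0
  have hF' : ∀ s ∈ F, s ∈ σ ∧ 1 < c * s := fun s hs =>
    ⟨((hF s).1 hs).1, by linarith [((hF s).1 hs).2]⟩
  have hχ : ∀ s ∈ F, ContinuousOn (χ s) σ := fun s hs =>
    continuousOn_ite_eq_of_isolated (hiso s (hF' s hs).1 (hF' s hs).2)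
  have hproj : ∀ s ∈ F, ∀ u, inner ℂ (cfc (χ s) S u) u = ((‖cfc (χ s) S u‖ ^ 2 : ℝ) : ℂ) := by
    intro s hs u
    have h : cfc (χ s) S = cfc (χ s) S * cfc (χ s) S := by
      rw [← cfc_mul (χ s) (χ s) S (hχ s hs) (hχ s hs)]
      refine cfc_congr fun x _ => ?_
      by_cases hx : x = s <;> simp [χ, hx]
    have hsa : IsSelfAdjoint (cfc (χ s) S) := cfc_predicate _ _
    have h2 : cfc (χ s) S (cfc (χ s) S u) = cfc (χ s) S u := by
      conv_rhs => rw [h]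
      rfl
    have h3 := (ContinuousLinearMap.isSelfAdjoint_iff_isSymmetric.1 hsa) (cfc (χ s) S u) u
    simp only [ContinuousLinearMap.coe_coe, h2] at h3
    rw [h3, inner_self_eq_norm_sq_to_K]
    norm_cast
  refine ⟨F, fun s => cfc (χ s) S, hF', ?_, hproj, ?_⟩
  · intro s hs u
    have h : S * cfc (χ s) S = s • cfc (χ s) S := by
      calc S * cfc (χ s) S = cfc (fun x : ℝ => x) S * cfc (χ s) S := by rw [cfc_id' ℝ S]
        _ = cfc (fun x => x * χ s x) S :=
          (cfc_mul (fun x => x) (χ s) S continuousOn_id (hχ s hs)).symm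
        _ = cfc (fun x => s * χ s x) S := by
          refine cfc_congr fun x _ => ?_
          by_cases hx : x = s <;> simp [χ, hx]
        _ = s • cfc (χ s) S := cfc_const_mul s (χ s) S (hχ s hs)
    have := congrArg (fun B : V →L[ℂ] V => B u) h
    simpa using this
  · intro u
    have hcont : ∀ s ∈ F, ContinuousOn (fun x => (c * s - 1) * χ s x) σ := fun s hs =>
      continuousOn_const.mul (hχ s hs)
    have hle : cfc (fun x => c * x - (1 + ε)) S ≤ cfc (∑ s ∈ F, fun x => (c * s - 1) * χ s x) S := by
      refine cfc_mono ?_ (by fun_prop) (by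
        have := continuousOn_finsetSum F hcont
        convert this using 1
        ext x; simp)
      intro x hx
      simp only [Finset.sum_apply, χ, mul_ite, mul_one, mul_zero]
      by_cases hxF : x ∈ F
      · rw [Finset.sum_ite_eq F x, if_pos hxF]
        linarith
      · rw [Finset.sum_ite_eq F x, if_neg hxF]
        have : ¬ 1 + ε ≤ c * x := fun h => hxF ((hF x).2 ⟨hx, h⟩)
        linarith
    have hL : cfc (fun x => c * x - (1 + ε)) S = c • S - algebraMap ℝ (V →L[ℂ] V) (1 + ε) := by
      rw [cfc_sub (fun x => c * x) (fun _ => 1 + ε) S, cfc_const_mul_id c S, cfc_const (1 + ε) S]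
    have hR : cfc (∑ s ∈ F, fun x => (c * s - 1) * χ s x) S =
        ∑ s ∈ F, (c * s - 1) • cfc (χ s) S := by
      rw [cfc_sum (fun s x => (c * s - 1) * χ s x) S F hcont]
      exact Finset.sum_congr rfl fun s hs => cfc_const_mul _ _ S (hχ s hs)
    rw [hL, hR, ContinuousLinearMap.le_def] at hle
    have h := hle.re_inner_nonneg_left u
    have hsum : (inner ℂ ((∑ s ∈ F, (c * s - 1) • cfc (χ s) S) u) u).re =
        ∑ s ∈ F, (c * s - 1) * ‖cfc (χ s) S u‖ ^ 2 := by
      rw [_root_.sum_apply, sum_inner, Complex.re_sum]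
      refine Finset.sum_congr rfl fun s hs => ?_
      rw [_root_.smul_apply, inner_real_smul_left_complex, hproj s hs u,
        Complex.re_ofReal_mul, Complex.ofReal_re]
    have hone : (inner ℂ (algebraMap ℝ (V →L[ℂ] V) (1 + ε) u) u).re = (1 + ε) * ‖u‖ ^ 2 := by
      rw [Algebra.algebraMap_eq_smul_one, _root_.smul_apply, inner_real_smul_left_complex]
      simp [inner_self_eq_norm_sq_to_K, ← Complex.ofReal_pow]
    rw [_root_.sub_apply, _root_.sub_apply, inner_sub_left,
      inner_sub_left, _root_.smul_apply, inner_real_smul_left_complex] at h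
    simp only [map_sub, RCLike.re_to_complex, hsum, hone, Complex.re_ofReal_mul] at h
    linarith

end Bounded

/-! ### From the operator of a form to a bounded operator on the form domain -/

section Transfer

open ContinuousLinearMap (adjoint)

variable {E V : Type*} [NormedAddCommGroup E] [InnerProductSpace ℂ E]
  [NormedAddCommGroup V] [InnerProductSpace ℂ V]

/-- `H` is the operator on `E` associated with the form `⟨v, w⟩ - c ⟨j v, j w⟩`, whose domain is the
range of `j : V → E`. For a closed symmetric form `h`, the space `V` is the form domain with the
scalar product `h + c ⟨·, ·⟩`, and `j` is its inclusion. -/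
def IsAssociated (H : E →ₗ.[ℂ] E) (j : V →L[ℂ] E) (c : ℝ) : Prop :=
  ∀ u f : E, (u, f) ∈ H.graph ↔
    ∃ v : V, j v = u ∧ ∀ w : V, inner ℂ w v - (c : ℂ) * inner ℂ (j w) u = inner ℂ (j w) f

variable {H : E →ₗ.[ℂ] E} {j : V →L[ℂ] E} {c : ℝ}

theorem IsAssociated.inner_eq_zero_of_mem_eigenspace (hH : IsAssociated H j c) {μ ν : ℝ}
    (hμν : μ ≠ ν) {x y : E} (hx : x ∈ eigenspace H (μ : ℂ)) (hy : y ∈ eigenspace H (ν : ℂ)) :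
    inner ℂ x y = 0 := by
  have hlift : ∀ {m : ℝ} {u : E}, u ∈ eigenspace H (m : ℂ) →
      ∃ v : V, j v = u ∧ ∀ w : V, inner ℂ w v = ((c + m : ℝ) : ℂ) * inner ℂ (j w) u := by
    intro m u hu
    obtain ⟨hd, hmu⟩ := (mem_eigenspace H _ u).1 hu
    have hgraph : (u, (m : ℂ) • u) ∈ H.graph := by
      rw [← hmu]; exact H.mem_graph ⟨u, hd⟩
    obtain ⟨v, hv, hw⟩ := (hH _ _).1 hgraph
    refine ⟨v, hv, fun w => ?_⟩
    have h := hw w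
    rw [inner_smul_right, sub_eq_iff_eq_add] at h
    rw [h]; push_cast; ring
  obtain ⟨v, rfl, hv⟩ := hlift hx
  obtain ⟨w, rfl, hw⟩ := hlift hy
  have h1 := hw v
  have h2 := congrArg (starRingEnd ℂ) (hv w)
  rw [inner_conj_symm, map_mul, Complex.conj_ofReal, inner_conj_symm, h1, ← sub_eq_zero,
    ← sub_mul, mul_eq_zero] at h2
  refine h2.resolve_left fun h => hμν ?_
  have h' : c + ν - (c + μ) = 0 := by exact_mod_cast h
  linarith

theorem IsEigenvalue.mem_spectrum {T : E →ₗ.[ℂ] E} {z : ℂ} (hz : IsEigenvalue T z) :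
    z ∈ spectrum T := by
  rintro ⟨R, -, hR⟩
  obtain ⟨u, hu, hTu⟩ := hz
  apply hu
  rw [← hR u, hTu, sub_self, map_zero]

/-- A negative eigenvalue of `T`. -/
abbrev NegEigenvalue (T : E →ₗ.[ℂ] E) : Type :=
  {t : ℝ // t < 0 ∧ IsEigenvalue T t}

theorem NegSpectrumDiscrete.finiteDimensional {T : E →ₗ.[ℂ] E} (hT : NegSpectrumDiscrete T)
    (μ : NegEigenvalue T) : FiniteDimensional ℂ (eigenspace T (μ.1 : ℂ)) :=
  (hT μ.1 ⟨μ.2.1, μ.2.2.mem_spectrum⟩).2.2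

variable [CompleteSpace E] [CompleteSpace V]

theorem inner_adjoint_comp_self (j : V →L[ℂ] E) (v w : V) :
    inner ℂ (adjoint j (j v)) w = inner ℂ (j v) (j w) :=
  ContinuousLinearMap.adjoint_inner_left j w (j v)

/-- If `t⁻¹ - c` is in the resolvent set of `H`, with resolvent `R`, then `b = j† (t⁻¹ R - 1)` is a
lift of `R` along `j`, from which an inverse of `t - j† j` is computed. -/
theorem IsAssociated.notMem_spectrum (hH : IsAssociated H j c) {t : ℝ} (ht : t ≠ 0)
    (hR : ((t⁻¹ - c : ℝ) : ℂ) ∈ resolventSet H) :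
    t ∉ _root_.spectrum ℝ (adjoint j ∘L j) := by
  obtain ⟨R, hR, -⟩ := hR
  have htc : (t : ℂ) ≠ 0 := by exact_mod_cast ht
  set b : E →L[ℂ] V := adjoint j ∘L ((t : ℂ)⁻¹ • R - 1) with hb
  have hbx : ∀ x, b x = (t : ℂ)⁻¹ • adjoint j (R x) - adjoint j x := fun x => by
    simp [hb]
  have hjb : ∀ x, j (b x) = R x := by
    intro x
    obtain ⟨hd, hx⟩ := hR x
    have hgraph : (R x, H ⟨R x, hd⟩) ∈ H.graph := H.mem_graph ⟨R x, hd⟩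
    obtain ⟨v, hv, hw⟩ := (hH _ _).1 hgraph
    have hHx : H ⟨R x, hd⟩ = ((t⁻¹ - c : ℝ) : ℂ) • R x - x := by
      rw [eq_sub_iff_add_eq, ← eq_sub_iff_add_eq']; exact hx.symm
    have : v = b x := by
      refine ext_inner_left ℂ fun w => ?_
      have h := hw w
      rw [hHx, inner_sub_right, inner_smul_right, sub_eq_iff_eq_add] at h
      rw [h, hbx, inner_sub_right, inner_smul_right, ContinuousLinearMap.adjoint_inner_right,
        ContinuousLinearMap.adjoint_inner_right]
      push_cast
      ring
    rw [← this, hv]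
  set S : V →L[ℂ] V := adjoint j ∘L j with hS
  have hsa : IsSelfAdjoint (algebraMap ℝ (V →L[ℂ] V) t - S) :=
    ((IsSelfAdjoint.all t).algebraMap _).sub
      (ContinuousLinearMap.isPositive_adjoint_comp_self j).isSelfAdjoint
  set Q : V →L[ℂ] V := (t : ℂ)⁻¹ • (1 - (t : ℂ)⁻¹ • (b ∘L j))
  have hright : (algebraMap ℝ (V →L[ℂ] V) t - S) * Q = 1 := by
    ext y
    have halg : ∀ x : V, (algebraMap ℝ (V →L[ℂ] V) t) x = (t : ℂ) • x := fun x => by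
      rw [Algebra.algebraMap_eq_smul_one]; rfl
    have hSb : S (b (j y)) = adjoint j (R (j y)) := by
      rw [hS, ContinuousLinearMap.comp_apply, hjb]
    have hSy : S y = adjoint j (j y) := rfl
    have hQy : Q y = (t : ℂ)⁻¹ • (y - (t : ℂ)⁻¹ • b (j y)) := rfl
    have hexp : ((algebraMap ℝ (V →L[ℂ] V) t - S) * Q) y = (t : ℂ) • Q y - S (Q y) := by
      rw [← halg]; rfl
    rw [hexp, hQy, map_smul, map_sub, map_smul, hSb, hSy, hbx]
    simp only [smul_sub, smul_smul, mul_inv_cancel₀ htc, one_smul, ← mul_assoc, one_mul]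
    change _ = y
    abel
  have hleft : star Q * (algebraMap ℝ (V →L[ℂ] V) t - S) = 1 := by
    have := congrArg star hright
    rwa [star_mul, hsa.star_eq, star_one] at this
  rw [spectrum.notMem_iff]
  exact isUnit_iff_exists.2 ⟨Q, hright, by rwa [← left_inv_eq_right_inv hleft hright]⟩

theorem IsAssociated.map_mem_eigenspace (hH : IsAssociated H j c) {s : ℝ} (hs : s ≠ 0) {v : V}
    (hv : adjoint j (j v) = (s : ℂ) • v) : j v ∈ eigenspace H ((s⁻¹ - c : ℝ) : ℂ) := by
  have hsc : (s : ℂ) ≠ 0 := by exact_mod_cast hs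
  have hgraph : (j v, ((s⁻¹ - c : ℝ) : ℂ) • j v) ∈ H.graph := by
    refine (hH _ _).2 ⟨v, rfl, fun w => ?_⟩
    rw [inner_smul_right, ← ContinuousLinearMap.adjoint_inner_right, hv, inner_smul_right]
    push_cast
    field_simp
  obtain ⟨u, hu, hHu⟩ := (LinearPMap.mem_graph_iff H).1 hgraph
  rw [mem_eigenspace]
  obtain ⟨u, hud⟩ := u
  obtain rfl : u = j v := hu
  exact ⟨hud, hHu⟩

/-- The form of `H` is bounded from below by finitely many negative spectral components of `H`, up
to an error `ε` relative to the norm of `V`. -/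
theorem IsAssociated.exists_finset_le (hH : IsAssociated H j c) (hdisc : NegSpectrumDiscrete H)
    [∀ μ : NegEigenvalue H, FiniteDimensional ℂ (eigenspace H (μ.1 : ℂ))] {ε : ℝ} (hε : 0 < ε) :
    ∃ G : Finset (NegEigenvalue H), ∀ v : V, c * ‖j v‖ ^ 2 - ‖v‖ ^ 2 ≤
      ε * ‖v‖ ^ 2 + ∑ μ ∈ G, -μ.1 * ‖(eigenspace H (μ.1 : ℂ)).starProjection (j v)‖ ^ 2 := by
  classical
  set S : V →L[ℂ] V := adjoint j ∘L j
  have hpos : S.IsPositive := ContinuousLinearMap.isPositive_adjoint_comp_self j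
  have hnonneg : ∀ x ∈ _root_.spectrum ℝ S, 0 ≤ x :=
    spectrum_nonneg_of_nonneg ((ContinuousLinearMap.nonneg_iff_isPositive S).2 hpos)
  have hspos : ∀ s ∈ _root_.spectrum ℝ S, 1 < c * s → 0 < s := fun s hs h =>
    (hnonneg s hs).lt_of_ne (by rintro rfl; simp at h; linarith)
  have hneg : ∀ s ∈ _root_.spectrum ℝ S, 1 < c * s → s⁻¹ - c ∈ negSpectrum H := by
    intro s hs h
    have h0 := hspos s hs h
    refine ⟨?_, fun hR => hH.notMem_spectrum h0.ne' hR hs⟩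
    rw [sub_neg, inv_lt_iff_one_lt_mul₀ h0]
    exact h
  have hiso : ∀ s ∈ _root_.spectrum ℝ S, 1 < c * s →
      ∃ δ > 0, ∀ x ∈ _root_.spectrum ℝ S, dist x s < δ → x = s := by
    intro s hs h
    have h0 := hspos s hs h
    obtain ⟨⟨r, hr, hri⟩, -⟩ := hdisc _ (hneg s hs h)
    have hcont : ContinuousAt (fun x : ℝ => x⁻¹ - c) s :=
      (continuousAt_inv₀ h0.ne').sub continuousAt_const
    obtain ⟨δ, hδ, hd⟩ := Metric.eventually_nhds_iff.1
      ((hcont.eventually (Metric.ball_mem_nhds _ hr)).and (eventually_ne_nhds h0.ne'))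
    refine ⟨δ, hδ, fun x hx hxs => ?_⟩
    obtain ⟨h1, h2⟩ := hd hxs
    have h3 := hri ((x⁻¹ - c : ℝ) : ℂ) (fun hR => hH.notMem_spectrum h2 hR hx)
      (by rw [Complex.dist_of_im_eq (by simp)]; simpa using h1)
    have h4 : x⁻¹ - c = s⁻¹ - c := by exact_mod_cast h3
    exact inv_injective (by linarith)
  obtain ⟨F, P, hF, hSP, hPu, hle⟩ := exists_finset_projections S hpos.isSelfAdjoint c hiso hε
  let g : F → NegEigenvalue H := fun s => ⟨(s : ℝ)⁻¹ - c,
    (hneg s (hF s s.2).1 (hF s s.2).2).1, (hdisc _ (hneg s (hF s s.2).1 (hF s s.2).2)).2.1⟩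
  have hg : Function.Injective g := fun s t hst => by
    have : (s : ℝ)⁻¹ - c = (t : ℝ)⁻¹ - c := congrArg Subtype.val hst
    exact Subtype.ext (inv_injective (by linarith))
  refine ⟨Finset.univ.image g, fun v => ?_⟩
  rw [Finset.sum_image hg.injOn]
  have hSv : (inner ℂ (S v) v).re = ‖j v‖ ^ 2 := by
    rw [show S v = adjoint j (j v) from rfl, inner_adjoint_comp_self, ← RCLike.re_to_complex,
      inner_self_eq_norm_sq]
  refine (hSv ▸ hle v).trans ?_
  rw [← Finset.sum_coe_sort F]
  refine add_le_add le_rfl (Finset.sum_le_sum fun s _ => ?_)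
  obtain ⟨hsσ, hsc⟩ := hF s s.2
  have h0 := hspos s hsσ hsc
  set p := P s v
  have hp : adjoint j (j p) = ((s : ℝ) : ℂ) • p := hSP s s.2 v
  have hmem : j p ∈ eigenspace H ((g s).1 : ℂ) := hH.map_mem_eigenspace h0.ne' hp
  have hnorm : ‖j p‖ ^ 2 = s * ‖p‖ ^ 2 := by
    rw [← inner_self_eq_norm_sq (𝕜 := ℂ), ← inner_adjoint_comp_self, hp, inner_smul_left,
      inner_self_eq_norm_sq_to_K]
    simp [← Complex.ofReal_pow, ← Complex.ofReal_mul]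
  -- The spectral projections on `V` and on `E` are compared through `⟨j p, j v⟩ = ‖j p‖ ^ 2`.
  have hinner : inner ℂ (j p) (j v) = ((‖j p‖ ^ 2 : ℝ) : ℂ) := by
    rw [← inner_adjoint_comp_self, hp, inner_smul_left, hPu s s.2 v, hnorm, Complex.conj_ofReal]
    push_cast
    ring
  have hproj : ‖j p‖ ^ 2 ≤ ‖j p‖ * ‖(eigenspace H ((g s).1 : ℂ)).starProjection (j v)‖ := by
    have h : inner ℂ (j p) ((eigenspace H ((g s).1 : ℂ)).starProjection (j v)) =
        ((‖j p‖ ^ 2 : ℝ) : ℂ) := by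
      rw [← Submodule.inner_starProjection_left_eq_right,
        Submodule.starProjection_eq_self_iff.2 hmem, hinner]
    have h' := norm_inner_le_norm (𝕜 := ℂ) (j p)
      ((eigenspace H ((g s).1 : ℂ)).starProjection (j v))
    rwa [h, Complex.norm_real, Real.norm_of_nonneg (sq_nonneg _)] at h'
  have hjp : ‖j p‖ ≤ ‖(eigenspace H ((g s).1 : ℂ)).starProjection (j v)‖ := by
    by_contra! h
    nlinarith [norm_nonneg ((eigenspace H ((g s).1 : ℂ)).starProjection (j v))]
  have hcoef : (c * s - 1) * ‖p‖ ^ 2 = -(g s).1 * ‖j p‖ ^ 2 := by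
    rw [hnorm]
    simp only [g]
    field_simp
    ring
  have hpos' : 0 ≤ -(g s).1 := by linarith [(g s).2.1]
  exact hcoef.trans_le (mul_le_mul_of_nonneg_left (by gcongr) hpos')

end Transfer

/-! ### The form domain as a Hilbert space -/

universe u

namespace DenseForm

variable {E : Type u} [NormedAddCommGroup E] [InnerProductSpace ℂ E]

theorem symmPart_apply (a : DenseForm E) (u v : a.domain) :
    a.symmPart.form u v = (1 / 2 : ℂ) * (a.form u v + starRingEnd ℂ (a.form v u)) :=
  rfl

theorem symmPart_apply_self (a : DenseForm E) (u : a.domain) :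
    a.symmPart.form u u = ((a.form u u).re : ℂ) := by
  rw [symmPart_apply, Complex.add_conj]
  push_cast
  ring

theorem conj_symmPart_apply (a : DenseForm E) (u v : a.domain) :
    starRingEnd ℂ (a.symmPart.form v u) = a.symmPart.form u v := by
  simp only [symmPart_apply, map_add, map_mul, Complex.conj_conj, map_div₀, map_one, map_ofNat]
  ring

/-- The domain of `a` as a vector space without the norm that it inherits from `E`, so that it can
carry the form norm instead. -/
def FormDomain (a : DenseForm E) : Type _ :=
  a.domain

noncomputable instance (a : DenseForm E) : AddCommGroup a.FormDomain :=
  inferInstanceAs (AddCommGroup a.domain)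

noncomputable instance (a : DenseForm E) : Module ℂ a.FormDomain :=
  inferInstanceAs (Module ℂ a.domain)

/-- The inclusion of the form domain. -/
noncomputable def inclusion (a : DenseForm E) : a.FormDomain →ₗ[ℂ] E :=
  a.domain.subtype

/-- The symmetric part of `a`, as a form on the type synonym for its domain. -/
noncomputable def symmForm (a : DenseForm E) : a.FormDomain →ₗ[ℂ] a.FormDomain →ₗ⋆[ℂ] ℂ :=
  a.symmPart.form

theorem conj_symmForm_apply (a : DenseForm E) (u v : a.FormDomain) :
    starRingEnd ℂ (a.symmForm v u) = a.symmForm u v :=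
  a.conj_symmPart_apply u v

theorem BoundedBelowBy.symmForm_nonneg {a : DenseForm E} {η : ℝ} (hbelow : a.BoundedBelowBy η)
    (u : a.FormDomain) : 0 ≤ (a.symmForm u u).re + η * ‖a.inclusion u‖ ^ 2 := by
  have h : (a.symmForm u u).re = (a.form u u).re := 
    (congrArg Complex.re (a.symmPart_apply_self u)).trans (Complex.ofReal_re _)
  rw [h]
  exact hbelow u

theorem re_ofReal_mul_inner_self (r : ℝ) (x : E) :
    ((r : ℂ) * inner ℂ x x).re = r * ‖x‖ ^ 2 := by
  rw [Complex.re_ofReal_mul, ← RCLike.re_to_complex, inner_self_eq_norm_sq]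

/-- The scalar product `h(u, v) + (η + 1) ⟨u, v⟩` on the domain of `a`, where `h` is the symmetric
part of `a`; its norm is `a.formNorm η`. -/
noncomputable abbrev innerCore (a : DenseForm E) {η : ℝ} (hbelow : a.BoundedBelowBy η) :
    InnerProductSpace.Core ℂ a.FormDomain where
  inner u v := a.symmForm v u + ((η + 1 : ℝ) : ℂ) * inner ℂ (a.inclusion u) (a.inclusion v)
  conj_inner_symm u v := by
    rw [map_add, map_mul, inner_conj_symm, Complex.conj_ofReal, conj_symmForm_apply]
  re_inner_nonneg u := by
    have h := hbelow.symmForm_nonneg u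
    rw [RCLike.re_to_complex, Complex.add_re, re_ofReal_mul_inner_self]
    nlinarith [sq_nonneg ‖a.inclusion u‖]
  add_left u v w := by
    simp only [map_add, inner_add_left]
    ring
  smul_left u v r := by
    simp only [map_smul, map_smulₛₗ, inner_smul_left, smul_eq_mul]
    ring
  definite u hu := by
    have h := hbelow.symmForm_nonneg u
    have hu' := congrArg Complex.re hu
    rw [Complex.add_re, re_ofReal_mul_inner_self, Complex.zero_re] at hu'
    have h0 : ‖a.inclusion u‖ ^ 2 = 0 := by nlinarith [sq_nonneg ‖a.inclusion u‖]
    exact Subtype.ext (norm_eq_zero.1 (pow_eq_zero_iff two_ne_zero |>.1 h0))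

/-- The domain of a closed form that is bounded from below is a Hilbert space `V` for the scalar
product `h + (η + 1) ⟨·, ·⟩`, continuously embedded by `j`. -/
theorem exists_hilbert (a : DenseForm E) {η : ℝ} (hbelow : a.BoundedBelowBy η)
    (hclosed : a.IsClosedForm η) :
    ∃ (V : Type u) (_ : NormedAddCommGroup V) (_ : InnerProductSpace ℂ V) (_ : CompleteSpace V)
      (j : V →L[ℂ] E) (i : a.domain ≃ₗ[ℂ] V), (∀ u, j (i u) = u) ∧
      ∀ u v, inner ℂ (i u) (i v) =
        a.symmPart.form v u + ((η + 1 : ℝ) : ℂ) * inner ℂ (u : E) (v : E) := by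
  let core := a.innerCore hbelow
  let _ : NormedAddCommGroup a.FormDomain := core.toNormedAddCommGroup
  let _ : InnerProductSpace ℂ a.FormDomain := InnerProductSpace.ofCore core.toCore
  let i : a.domain ≃ₗ[ℂ] a.FormDomain := LinearEquiv.refl ℂ a.domain
  have hinner : ∀ u v : a.domain, inner ℂ (i u) (i v) =
      a.symmPart.form v u + ((η + 1 : ℝ) : ℂ) * inner ℂ (u : E) (v : E) := fun _ _ => rfl
  have hsq : ∀ u : a.domain, ‖i u‖ ^ 2 = (a.form u u).re + (η + 1) * ‖(u : E)‖ ^ 2 := by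
    intro u
    rw [← inner_self_eq_norm_sq (𝕜 := ℂ) (i u), hinner, symmPart_apply_self,
      inner_self_eq_norm_sq_to_K]
    simp [← Complex.ofReal_pow]
  have hnorm : ∀ u : a.domain, ‖i u‖ = a.formNorm η u := by
    intro u
    rw [formNorm, ← hsq, Real.sqrt_sq (norm_nonneg _)]
  have hcomplete : CompleteSpace a.FormDomain := by
    refine Metric.complete_of_cauchySeq_tendsto fun u hu => ?_
    obtain ⟨v, hv⟩ := hclosed (fun n => i.symm (u n)) fun ε hε => by
      obtain ⟨N, hN⟩ := Metric.cauchySeq_iff.1 hu ε hε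
      refine ⟨N, fun m hm n hn => ?_⟩
      rw [← hnorm, map_sub, i.apply_symm_apply, i.apply_symm_apply, ← dist_eq_norm]
      exact hN m hm n hn
    refine ⟨i v, tendsto_iff_norm_sub_tendsto_zero.2 ?_⟩
    simpa only [← hnorm, map_sub, i.apply_symm_apply] using hv
  have hbound : ∀ u : a.FormDomain, ‖a.inclusion u‖ ≤ 1 * ‖u‖ := by
    intro u
    obtain ⟨u, rfl⟩ := i.surjective u
    have h := hbelow u
    rw [one_mul]
    refine le_of_sq_le_sq ?_ (norm_nonneg _)
    rw [hsq, show a.inclusion (i u) = (u : E) from rfl]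
    linarith
  exact ⟨a.FormDomain, _, _, hcomplete, a.inclusion.mkContinuous 1 hbound, i, fun _ => rfl, hinner⟩

end DenseForm

/-! ### The eigenvalue sums -/

section Main

variable {E : Type u} [NormedAddCommGroup E] [InnerProductSpace ℂ E]

/-- The diagonal matrix entries of the operator are the values of the form on the diagonal. -/
theorem DenseForm.form_self_eq (a : DenseForm E) {u : E} (hu : u ∈ a.operator.domain) :
    a.form ⟨u, a.opDomain_le hu⟩ ⟨u, a.opDomain_le hu⟩ = inner ℂ u (a.operator ⟨u, hu⟩) :=
  a.opVal_spec ⟨u, hu⟩ ⟨u, a.opDomain_le hu⟩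

/-- Part of the trace is captured by finitely many eigenvalues of `H` and orthonormal bases of their
eigenspaces. -/
theorem sum_finrank_mul_le_trNegPow (H : E →ₗ.[ℂ] E)
    [∀ μ : NegEigenvalue H, FiniteDimensional ℂ (eigenspace H (μ.1 : ℂ))]
    (G : Finset (NegEigenvalue H)) (γ : ℝ) :
    ENNReal.ofReal (∑ μ ∈ G, Module.finrank ℂ (eigenspace H (μ.1 : ℂ)) * (-μ.1) ^ γ) ≤
      trNegPow H γ := by
  rw [ENNReal.ofReal_sum_of_nonneg fun μ _ =>
    mul_nonneg (Nat.cast_nonneg _) (Real.rpow_nonneg (by linarith [μ.2.1]) _)]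
  refine le_trans (Finset.sum_le_sum fun μ _ => ?_) (ENNReal.sum_le_tsum G)
  rw [edim_eq_finrank, ENNReal.ofReal_mul (Nat.cast_nonneg _), ENNReal.ofReal_natCast]
  simp

/-- If for every `ε > 0` finitely many eigenvalues of `H` control the numbers `y k` up to an error
`ε * C k`, in the sense of the diagonal entries in an orthonormal family `e`, then the sum of the
`y k ^ γ` is at most the trace. -/
theorem sum_rpow_le_trNegPow {κ : Type*} [Fintype κ] (H : E →ₗ.[ℂ] E)
    [∀ μ : NegEigenvalue H, FiniteDimensional ℂ (eigenspace H (μ.1 : ℂ))]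
    (horth : ∀ μ ν : NegEigenvalue H, μ ≠ ν → ∀ x ∈ eigenspace H (μ.1 : ℂ),
      ∀ y ∈ eigenspace H (ν.1 : ℂ), inner ℂ x y = 0)
    {e : κ → E} (he : Orthonormal ℂ e) {y C : κ → ℝ} (hy : ∀ k, 0 ≤ y k)
    (h : ∀ ε > 0, ∃ G : Finset (NegEigenvalue H), ∀ k, y k ≤ ε * C k +
      ∑ μ ∈ G, -μ.1 * ‖(eigenspace H (μ.1 : ℂ)).starProjection (e k)‖ ^ 2) {γ : ℝ} (hγ : 1 ≤ γ) :
    ENNReal.ofReal (∑ k, y k ^ γ) ≤ trNegPow H γ := by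
  have hγ0 : 0 ≤ γ := by linarith
  have key : ∀ ε > 0, ENNReal.ofReal (∑ k, (max (y k - ε * C k) 0) ^ γ) ≤ trNegPow H γ := by
    intro ε hε
    obtain ⟨G, hG⟩ := h ε hε
    refine le_trans (ENNReal.ofReal_le_ofReal ?_) (sum_finrank_mul_le_trNegPow H G γ)
    let φ : (Σ μ : G, Fin (Module.finrank ℂ (eigenspace H (μ.1.1 : ℂ)))) → E :=
      fun a => (stdOrthonormalBasis ℂ (eigenspace H (a.1.1.1 : ℂ)) a.2 : E)
    have hfam : OrthogonalFamily ℂ (fun μ : G => eigenspace H (μ.1.1 : ℂ))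
        fun μ => (eigenspace H (μ.1.1 : ℂ)).subtypeₗᵢ := fun μ ν hμν x y =>
      horth μ.1 ν.1 (fun h => hμν (Subtype.ext h)) x x.2 y y.2
    have hφ : Orthonormal ℂ φ := hfam.orthonormal_sigma_orthonormal fun μ =>
      (stdOrthonormalBasis ℂ (eigenspace H (μ.1.1 : ℂ))).orthonormal
    have hmain := sum_rpow_le_of_le_sum_inner he hφ (x := fun a => -a.1.1.1)
      (y := fun k => max (y k - ε * C k) 0) (fun a => by linarith [a.1.1.2.1])
      (fun k => le_max_right _ _) (fun k => ?_) hγ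
    · refine hmain.trans_eq ?_
      rw [Fintype.sum_sigma, ← Finset.sum_coe_sort G]
      simp
    · have hsum : ∑ a, -a.1.1.1 * ‖inner ℂ (φ a) (e k)‖ ^ 2 =
          ∑ μ ∈ G, -μ.1 * ‖(eigenspace H (μ.1 : ℂ)).starProjection (e k)‖ ^ 2 := by
        rw [Fintype.sum_sigma, ← Finset.sum_coe_sort G]
        refine Finset.sum_congr rfl fun μ _ => ?_
        change ∑ i, -μ.1.1 * ‖inner ℂ (φ ⟨μ, i⟩) (e k)‖ ^ 2 = _
        rw [← Finset.mul_sum, Submodule.starProjection_apply, ← Submodule.coe_norm,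
          ← (stdOrthonormalBasis ℂ (eigenspace H (μ.1.1 : ℂ))).sum_sq_norm_inner_right]
        congr 1
        refine Finset.sum_congr rfl fun i _ => ?_
        rw [Submodule.inner_orthogonalProjectionOnto_eq_of_mem_left]
      rw [hsum]
      refine max_le (by linarith [hG k]) (Finset.sum_nonneg fun μ _ => ?_)
      exact mul_nonneg (by linarith [μ.2.1]) (sq_nonneg _)
  have hcont : Continuous fun ε : ℝ => ENNReal.ofReal (∑ k, (max (y k - ε * C k) 0) ^ γ) := by
    refine ENNReal.continuous_ofReal.comp (continuous_finsetSum _ fun k _ => ?_)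
    exact (by fun_prop : Continuous fun ε : ℝ => max (y k - ε * C k) 0).rpow_const
      fun _ => Or.inr hγ0
  have hlim := (hcont.tendsto 0).mono_left (nhdsWithin_le_nhds (s := Set.Ioi 0))
  simp only [zero_mul, sub_zero, max_eq_left (hy _)] at hlim
  exact le_of_tendsto hlim (by filter_upwards [self_mem_nhdsWithin] with ε hε using key ε hε)

/-- The Hilbert space `V` of a closed form that is bounded from below, in terms of the operator of
the symmetric part and of the quadratic form `Re a(u, u)`. -/
theorem DenseForm.exists_isAssociated [CompleteSpace E] (a : DenseForm E) {η : ℝ}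
    (hbelow : a.BoundedBelowBy η) (hclosed : a.IsClosedForm η) :
    ∃ (V : Type u) (_ : NormedAddCommGroup V) (_ : InnerProductSpace ℂ V) (_ : CompleteSpace V)
      (j : V →L[ℂ] E) (i : a.domain → V), (∀ u, j (i u) = u) ∧
      IsAssociated a.symmPart.operator j (η + 1) ∧
      ∀ u : a.domain, (η + 1) * ‖(u : E)‖ ^ 2 - ‖i u‖ ^ 2 = -(a.form u u).re := by
  obtain ⟨V, _, _, _, j, i, hji, hinner⟩ := a.exists_hilbert hbelow hclosed
  refine ⟨V, _, _, inferInstance, j, i, hji, fun u f => ?_, fun u => ?_⟩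
  · rw [DenseForm.mem_graph_operator]
    constructor
    · rintro ⟨hu, hf⟩
      refine ⟨i ⟨u, hu⟩, hji _, fun w => ?_⟩
      obtain ⟨w, rfl⟩ := i.surjective w
      rw [hinner, hji, ← hf w]
      exact add_sub_cancel_right _ _
    · rintro ⟨v, rfl, hv⟩
      obtain ⟨v, rfl⟩ := i.surjective v
      rw [hji]
      refine ⟨v.2, fun (w : a.domain) => ?_⟩
      have h : inner ℂ (i w) (i v) - ((η + 1 : ℝ) : ℂ) * inner ℂ (j (i w)) (j (i v)) =
        inner ℂ (j (i w)) f := hv (i w)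
      rw [hinner, hji, hji, add_sub_cancel_right] at h
      exact h
  · rw [← inner_self_eq_norm_sq (𝕜 := ℂ) (i u), hinner, DenseForm.symmPart_apply_self,
      inner_self_eq_norm_sq_to_K]
    simp [← Complex.ofReal_pow]

theorem DenseForm.not_isEigenvalue_of_negSpectrum_eq_empty [CompleteSpace E] (a : DenseForm E)
    {η : ℝ} (hbelow : a.BoundedBelowBy η) (hclosed : a.IsClosedForm η)
    (hempty : negSpectrum a.symmPart.operator = ∅) {z : ℂ} (hz : z.re < 0) :
    ¬ IsEigenvalue a.operator z := by
  obtain ⟨V, _, _, _, j, i, hji, hassoc, hre⟩ := a.exists_isAssociated hbelow hclosed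
  rintro ⟨u, hu, hAu⟩
  have hdisc : NegSpectrumDiscrete a.symmPart.operator := fun t ht => by simp [hempty] at ht
  have := hdisc.finiteDimensional
  have hnone : IsEmpty (NegEigenvalue a.symmPart.operator) :=
    ⟨fun μ => Set.eq_empty_iff_forall_notMem.1 hempty μ.1 ⟨μ.2.1, μ.2.2.mem_spectrum⟩⟩
  set K := ‖i ⟨u, a.opDomain_le u.2⟩‖ ^ 2
  have hK : 0 ≤ K := sq_nonneg _
  have hd : 0 < -z.re * ‖(u : E)‖ ^ 2 := mul_pos (neg_pos.2 hz) (by positivity)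
  have hle : ∀ ε > 0, -z.re * ‖(u : E)‖ ^ 2 ≤ ε * K := by
    intro ε hε
    obtain ⟨G, hG⟩ := hassoc.exists_finset_le hdisc hε
    have h := hG (i ⟨u, a.opDomain_le u.2⟩)
    rw [hji, hre, a.form_self_eq u.2, hAu, inner_smul_right, inner_self_eq_norm_sq_to_K,
      Finset.eq_empty_of_isEmpty G, Finset.sum_empty, add_zero] at h
    simpa [← Complex.ofReal_pow] using h
  -- The value `ε = d / (K + 1)` contradicts `0 < d ≤ ε * K` for `d = -Re z * ‖u‖ ^ 2`.
  have h := hle (-z.re * ‖(u : E)‖ ^ 2 / (K + 1)) (by positivity)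
  rw [div_mul_eq_mul_div, le_div_iff₀ (by positivity)] at h
  linarith

theorem DenseForm.sum_rpow_neg_re_le_trNegPow [CompleteSpace E] (a : DenseForm E) {η : ℝ}
    (hbelow : a.BoundedBelowBy η) (hclosed : a.IsClosedForm η)
    (hdisc : NegSpectrumDiscrete a.symmPart.operator) {γ : ℝ} (hγ : 1 ≤ γ) {N : ℕ}
    {lam : Fin N → ℂ} (hlam : ∀ k, (lam k).re < 0)
    (hmult : ∀ z : ℂ, (((Finset.univ.filter fun k => lam k = z).card : ℕ) : ℕ∞) ≤
      algMult a.operator z) :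
    ENNReal.ofReal (∑ k, (-(lam k).re) ^ γ) ≤ trNegPow a.symmPart.operator γ := by
  obtain ⟨V, _, _, _, j, i, hji, hassoc, hre⟩ := a.exists_isAssociated hbelow hclosed
  have := hdisc.finiteDimensional
  obtain ⟨e, W, he, -, -, -, -, hdiag⟩ := exists_orthonormal_invariant a.operator N lam hmult
  choose hd hdiag using hdiag
  refine sum_rpow_le_trNegPow a.symmPart.operator ?_ he (y := fun k => -(lam k).re)
    (C := fun k => ‖i ⟨e k, a.opDomain_le (hd k)⟩‖ ^ 2) (fun k => by linarith [hlam k]) ?_ hγ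
  · intro μ ν hμν x hx y hy
    exact hassoc.inner_eq_zero_of_mem_eigenspace (fun h => hμν (Subtype.ext h)) hx hy
  · intro ε hε
    obtain ⟨G, hG⟩ := hassoc.exists_finset_le hdisc hε
    refine ⟨G, fun k => ?_⟩
    have h := hG (i ⟨e k, a.opDomain_le (hd k)⟩)
    rwa [hji, hre, a.form_self_eq (hd k), hdiag] at h

end Main

end LiebThirring

theorem theorem2p1 {E : Type*} [NormedAddCommGroup E] [InnerProductSpace ℂ E] [CompleteSpace E]
    (a : LiebThirring.DenseForm E) (η : ℝ) (hbelow : a.BoundedBelowBy η)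
    (hcont : a.IsContinuousForm η) (hclosed : a.IsClosedForm η) :
    (LiebThirring.negSpectrum a.symmPart.operator = ∅ →
      ∀ z : ℂ, z.re < 0 → ¬ LiebThirring.IsEigenvalue a.operator z) ∧
    (LiebThirring.NegSpectrumDiscrete a.symmPart.operator →
      ∀ γ : ℝ, 1 ≤ γ → ∀ (N : ℕ) (lam : Fin N → ℂ),
        (∀ k, LiebThirring.IsEigenvalue a.operator (lam k) ∧ (lam k).re < 0) →
        (∀ z : ℂ, (((Finset.univ.filter fun k => lam k = z).card : ℕ) : ℕ∞) ≤
          LiebThirring.algMult a.operator z) →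
        ENNReal.ofReal (∑ k, (-(lam k).re) ^ γ) ≤
          LiebThirring.trNegPow a.symmPart.operator γ) :=
  ⟨fun hempty _ hz => a.not_isEigenvalue_of_negSpectrum_eq_empty hbelow hclosed hempty hz,
    fun hdisc _ hγ _ _ hlam hmult =>
      a.sum_rpow_neg_re_le_trNegPow hbelow hclosed hdisc hγ (fun k => (hlam k).2) hmult⟩
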